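/- Let $0\le r\le n$ be integers. For real $n$-tuples $\alpha(1)=(\alpha_1(1),\dots,\alpha_n(1))$ and $\alpha(2)=(\alpha_1(2),\dots,\alpha_n(2))$ consider the inequalities - $(\dagger)$: $\alpha_i(s)\ge\alpha_{i+1}(s)$ for $s=1,2$ and $1\le i\le n-1$; - $(\triangleright)$: $\alpha_i(1)+\alpha_j(2)\ge 0$ for all $1\le i,j\le n$ with $i+j=n+1$; - $(\triangleleft)$: $\alpha_i(1)+\alpha_j(2)\le 0$ for all $1\le i,j\le n$ with $i+j=n+r+1$. (a) If $\alpha(1),\alpha(2)$ satisfy $(\dagger)$, then there exist Hermitian $n\times n$ matrices $A(1),A(2)$ whose eigenvalues, counted with multiplicity, are $\alpha(1),\alpha(2)$, and such that $A(1)+A(2)$ is positive semidefinite of rank at most $r$, if and only if $(\triangleright)$ and $(\triangleleft)$ hold. Let $C\subseteq\mathbb{R}^{n}\times\mathbb{R}^{n}$ be the cone of admissible eigenvalues, that is, the set of pairs $(\alpha(1),\alpha(2))$ satisfying $(\dagger)$ for which matrices as in (a) exist. A list of linear inequalities is called independent if each of them, when turned into an equality, cuts out of $C$ a facet (a face of dimension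 $\dim C-1$), distinct inequalities of the list cut out distinct facets, and no inequality of the list is implied by the other inequalities of the list. (b) If $r\ge 1$, then the inequalities $(\triangleright)$ and $(\triangleleft)$ are independent. (c) If $r=1$, then $(\triangleright)$ and $(\triangleleft)$ imply $(\dagger)$, for arbitrary real $n$-tuples $\alpha(1),\alpha(2)$. (d) If $r\ge 2$, then the inequalities $(\dagger)$, $(\triangleright)$ and $(\triangleleft)$ together are independent. -/

import Mathlib

open scoped ComplexOrder

/-- The eigenvalues of the complex matrix `A`, counted with multiplicity, are the entries of the
real tuple `a`. -/
def HasEigenvalues {n : ℕ} (A : Matrix (Fin n) (Fin n) ℂ) (a : Fin n → ℝ) : Prop :=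
  A.charpoly.roots = Finset.univ.val.map (fun i => (a i : ℂ))

/-- A pair of real `n`-tuples: `α 0` is the first tuple and `α 1` is the second one. -/
abbrev TuplePair (n : ℕ) : Type := Fin 2 → Fin n → ℝ

/-- There are Hermitian `n × n` matrices with eigenvalues `α 0` and `α 1` whose sum is positive
semidefinite of rank at most `r`. -/
def Realizable {n : ℕ} (r : ℕ) (α : TuplePair n) : Prop :=
  ∃ A : Fin 2 → Matrix (Fin n) (Fin n) ℂ,
    (∀ s, (A s).IsHermitian ∧ HasEigenvalues (A s) (α s)) ∧
      (A 0 + A 1).PosSemidef ∧ (A 0 + A 1).rank ≤ r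

/-- The cone of admissible eigenvalues: pairs of weakly decreasing tuples that are realizable. -/
def admissibleCone (n r : ℕ) : Set (TuplePair n) :=
  {α | (∀ s, Antitone (α s)) ∧ Realizable r α}

/-- Pairs `(i, j)` of indices with `i + j = c`, where the indices are counted from `1`. -/
abbrev SumIndex (n c : ℕ) : Type :=
  {p : Fin n × Fin n // ((p.1 : ℕ) + 1) + ((p.2 : ℕ) + 1) = c}

/-- A tuple index `s` and a pair `(i, j)` of consecutive entries, `j = i + 1`. -/
abbrev OrderIndex (n : ℕ) : Type :=
  Fin 2 × {p : Fin n × Fin n // (p.1 : ℕ) + 1 = (p.2 : ℕ)}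

/-- The order inequalities `α s i ≥ α s (i + 1)`, written as `0 ≤ orderForm n k α`. -/
def orderForm (n : ℕ) (k : OrderIndex n) (α : TuplePair n) : ℝ :=
  α k.1 k.2.1.1 - α k.1 k.2.1.2

/-- The inequalities `α 0 i + α 1 j ≥ 0` for `i + j = n + 1`, as `0 ≤ positivityForm n k α`. -/
def positivityForm (n : ℕ) (k : SumIndex n (n + 1)) (α : TuplePair n) : ℝ :=
  α 0 k.1.1 + α 1 k.1.2

/-- The inequalities `α 0 i + α 1 j ≤ 0` for `i + j = n + r + 1`, as `0 ≤ rankForm n r k α`. -/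
def rankForm (n r : ℕ) (k : SumIndex n (n + r + 1)) (α : TuplePair n) : ℝ :=
  -(α 0 k.1.1 + α 1 k.1.2)

/-- The two families of eigenvalue inequalities taken together. -/
def eigenvalueForms (n r : ℕ) :
    SumIndex n (n + 1) ⊕ SumIndex n (n + r + 1) → TuplePair n → ℝ :=
  Sum.elim (positivityForm n) (rankForm n r)

/-- The order inequalities together with the two families of eigenvalue inequalities. -/
def allForms (n r : ℕ) :
    OrderIndex n ⊕ (SumIndex n (n + 1) ⊕ SumIndex n (n + r + 1)) → TuplePair n → ℝ :=
  Sum.elim (orderForm n) (eigenvalueForms n r)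

/-- `F` is a facet of `C`: a nonempty (exposed) face whose dimension is one less than that
of `C`. -/
def IsFacet {n : ℕ} (C F : Set (TuplePair n)) : Prop :=
  F.Nonempty ∧ IsExposed ℝ C F ∧
    Module.finrank ℝ (vectorSpan ℝ F) + 1 = Module.finrank ℝ (vectorSpan ℝ C)

/-- The inequalities `0 ≤ f k α` are independent, as inequalities on the cone `C`: turning them
into equalities gives facets of `C`, distinct ones for distinct inequalities; and none of the
inequalities is implied by the remaining ones. -/
structure IndependentInequalities {n : ℕ} {κ : Type} (C : Set (TuplePair n))
    (f : κ → TuplePair n → ℝ) : Prop where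
  facet : ∀ k, IsFacet C {α ∈ C | f k α = 0}
  distinct : Function.Injective (fun k => {α ∈ C | f k α = 0})
  irredundant : ∀ k, ∃ α, f k α < 0 ∧ ∀ l, l ≠ k → 0 ≤ f l α

/-! ### Rank one perturbations of a diagonal matrix with interlacing spectrum -/

section RankOnePerturbation

open Polynomial

/-! Let `a` be the spectrum of A(1) and `b` that of -A(2), both in decreasing order. Then A(1) is
-A(2) plus a positive semidefinite matrix of rank at most r; (▷) reads b_i ≤ a_i and (◁) reads a_i ≤
b_{i-r}.

Necessity is Weyl's argument: a dimension count gives a nonzero vector on which both quadratic forms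
are controlled (`exists_ne_zero_mulVec_eq_zero`). For sufficiency, `cappedShift` leads from `b` to
`a` in r stages, consecutive stages interlacing. Each stage is a rank one perturbation, whose vector
is read off from a partial fraction expansion with nonnegative coefficients
(`exists_nonneg_partial_fractions`).

By (a) the cone is polyhedral. Independence then needs only a point where all inequalities are
strict and, for each listed inequality, a point where it alone is tight
(`independentInequalities_of_witnesses`); these points are explicit. For r = 1 the inequalities
interlace the two tuples, which forces (†). -/

lemma mul_prod_ite_ne {R : Type*} [CommRing R] {n : ℕ} (f : Fin n → R) (i : Fin n) :
    f i * ∏ j, (if j = i then 1 else f j) = ∏ j, f j := by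
  have h : f i = ∏ j, (if j = i then f j else 1) := by simp
  rw [h, ← Finset.prod_mul_distrib]
  exact Finset.prod_congr rfl fun j _ => by split_ifs <;> simp

/-- If `a` and `b` interlace, then `∏ (X - aᵢ) / ∏ (X - bᵢ) = 1 - ∑ cᵢ / (X - bᵢ)` with
nonnegative `cᵢ`. -/
lemma exists_nonneg_partial_fractions {n : ℕ} (a b : Fin n → ℝ) (hba : ∀ i, b i ≤ a i)
    (hab : ∀ i j, i < j → a j ≤ b i) :
    ∃ c : Fin n → ℝ, (∀ i, 0 ≤ c i) ∧
      ∏ i, (X - C (a i)) = ∏ i, (X - C (b i)) -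
        ∑ i, C (c i) * ∏ j, (if j = i then 1 else X - C (b j)) := by
  induction n with
  | zero => exact ⟨0, by simp, by simp⟩
  | succ n ih =>
    obtain ⟨c, hc, h⟩ := ih (fun i => a i.castSucc) (fun i => b i.castSucc)
      (fun i => hba _) (fun i j hij => hab _ _ (by simpa using hij))
    set x := b (Fin.last n) with hx
    set y := a (Fin.last n) with hy
    have hxy : x ≤ y := hba _
    have hyb : ∀ i : Fin n, y ≤ b i.castSucc := fun i => hab _ _ (Fin.castSucc_lt_last i)
    obtain hxy | hxy := hxy.eq_or_lt
    · refine ⟨Fin.snoc c 0, fun i => ?_, ?_⟩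
      · refine Fin.lastCases ?_ (fun i => ?_) i <;> simp [hc]
      · simp only [Fin.prod_univ_castSucc, Fin.sum_univ_castSucc, Fin.snoc_castSucc,
          Fin.snoc_last, Fin.castSucc_inj, (Fin.castSucc_lt_last _).ne', if_false, ← hx, ← hy, h,
          ← hxy, map_zero, zero_mul, add_zero, sub_mul, Finset.sum_mul, mul_assoc]
    · have hpos : ∀ i : Fin n, 0 < b i.castSucc - x := fun i => by linarith [hyb i]
      -- These are the residues after multiplying by (X - y)/(X - x) = 1 - (y - x)/(X - x), where (X
      -- - y)/((X - b_i)(X - x)) has residue (b_i - y)/(b_i - x) at b_i and (y - x)/(b_i - x) at x.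
      -- All are nonnegative because x < y ≤ b_i.
      refine ⟨Fin.snoc (fun i => c i * ((b i.castSucc - y) / (b i.castSucc - x)))
        ((y - x) * (1 + ∑ i, c i / (b i.castSucc - x))), fun i => ?_, ?_⟩
      · refine Fin.lastCases ?_ (fun i => ?_) i
        · simp only [Fin.snoc_last]
          exact mul_nonneg (by linarith)
            (add_nonneg zero_le_one (Finset.sum_nonneg fun i _ => div_nonneg (hc i) (hpos i).le))
        · simp only [Fin.snoc_castSucc]
          exact mul_nonneg (hc i) (div_nonneg (by linarith [hyb i]) (hpos i).le)
      · simp only [Fin.prod_univ_castSucc, Fin.sum_univ_castSucc, Fin.snoc_castSucc,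
          Fin.snoc_last, Fin.castSucc_inj, (Fin.castSucc_lt_last _).ne,
          (Fin.castSucc_lt_last _).ne', if_false, if_true, ← hx, ← hy, h, mul_one]
        have key : ∀ i : Fin n,
            C (c i) * (∏ j : Fin n, if j = i then 1 else X - C (b j.castSucc)) * (X - C y) =
            C (c i * ((b i.castSucc - y) / (b i.castSucc - x))) *
              ((∏ j : Fin n, if j = i then 1 else X - C (b j.castSucc)) * (X - C x)) +
            C ((y - x) * (c i / (b i.castSucc - x))) * ∏ j : Fin n, (X - C (b j.castSucc)) := by
          intro i
          rw [← mul_prod_ite_ne (fun j : Fin n => X - C (b j.castSucc)) i]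
          obtain ⟨q, hq⟩ : ∃ q, q = c i / (b i.castSucc - x) := ⟨_, rfl⟩
          have hcq : c i = q * (b i.castSucc - x) := by
            rw [hq, div_mul_cancel₀ _ (hpos i).ne']
          have h2 : c i * ((b i.castSucc - y) / (b i.castSucc - x)) = q * (b i.castSucc - y) := by
            rw [hq]; ring
          rw [h2, ← hq, hcq]
          simp only [map_mul, map_sub]
          ring
        rw [sub_mul, Finset.sum_mul, Finset.sum_congr rfl fun i _ => key i,
          Finset.sum_add_distrib, ← Finset.sum_mul, ← map_sum, ← Finset.mul_sum, mul_add, map_add]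
        simp only [map_mul, map_sub, mul_one]
        ring

/-- Factoring out the diagonal leaves a rank one perturbation of the identity, to which the matrix
determinant lemma applies. Division by `d i` needs a field; the polynomial entries X - b_i are
handled afterwards in the fraction field. -/
lemma det_diagonal_sub_vecMulVec_of_field {K : Type*} [Field K] {n : ℕ} (d u v : Fin n → K)
    (hd : ∀ i, d i ≠ 0) :
    (Matrix.diagonal d - Matrix.vecMulVec u v).det =
      ∏ i, d i - ∑ i, u i * v i * ∏ j, (if j = i then 1 else d j) := by
  have h : Matrix.diagonal d - Matrix.vecMulVec u v = Matrix.diagonal d *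
      (1 + Matrix.replicateCol Unit (fun i => -(u i / d i)) * Matrix.replicateRow Unit v) := by
    ext i j
    rw [Matrix.diagonal_mul]
    have := hd i
    by_cases hij : i = j
    · subst hij
      simp [Matrix.vecMulVec_apply, Matrix.mul_apply]
      field_simp
      ring
    · simp [Matrix.vecMulVec_apply, Matrix.mul_apply, hij]
      field_simp
  rw [h, Matrix.det_mul, Matrix.det_one_add_replicateCol_mul_replicateRow, Matrix.det_diagonal,
    mul_add, mul_one, sub_eq_add_neg, dotProduct, Finset.mul_sum, ← Finset.sum_neg_distrib]
  congr 1
  refine Finset.sum_congr rfl fun i _ => ?_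
  rw [← mul_prod_ite_ne d i]
  have := hd i
  field_simp

/-- The determinant of a rank one perturbation of a diagonal matrix. -/
lemma det_diagonal_sub_vecMulVec {R : Type*} [CommRing R] [IsDomain R] {n : ℕ}
    (d u v : Fin n → R) (hd : ∀ i, d i ≠ 0) :
    (Matrix.diagonal d - Matrix.vecMulVec u v).det =
      ∏ i, d i - ∑ i, u i * v i * ∏ j, (if j = i then 1 else d j) := by
  have hinj := IsFractionRing.injective R (FractionRing R)
  apply hinj
  have := det_diagonal_sub_vecMulVec_of_field (fun i => algebraMap R (FractionRing R) (d i))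
    (fun i => algebraMap R (FractionRing R) (u i)) (fun i => algebraMap R (FractionRing R) (v i))
    (fun i => by simpa using hd i)
  rw [RingHom.map_det]
  simp only [map_sub, map_prod, map_sum, map_mul, apply_ite (algebraMap R (FractionRing R)),
    map_one]
  rw [← this]
  congr 1
  ext i j
  by_cases hij : i = j <;> simp [Matrix.vecMulVec_apply, hij]

lemma hasEigenvalues_of_charpoly {n : ℕ} {A : Matrix (Fin n) (Fin n) ℂ} {a : Fin n → ℝ}
    (h : A.charpoly = ∏ i, (X - C (a i : ℂ))) : HasEigenvalues A a := by
  rw [HasEigenvalues, h, Polynomial.roots_prod]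
  · simp
  · simp [Finset.prod_ne_zero_iff, Polynomial.X_sub_C_ne_zero]

/-- A diagonal matrix has a positive semidefinite rank one perturbation with any prescribed
interlacing spectrum. -/
lemma exists_hasEigenvalues_diagonal_add_vecMulVec {n : ℕ} (a b : Fin n → ℝ)
    (hba : ∀ i, b i ≤ a i) (hab : ∀ i j, i < j → a j ≤ b i) :
    ∃ w : Fin n → ℂ, HasEigenvalues
      (Matrix.diagonal (fun i => (b i : ℂ)) + Matrix.vecMulVec w (star w)) a := by
  obtain ⟨c, hc, h⟩ := exists_nonneg_partial_fractions a b hba hab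
  -- Only the products w_i * conj w_i = c_i enter the characteristic polynomial.
  refine ⟨fun i => (Real.sqrt (c i) : ℂ), hasEigenvalues_of_charpoly ?_⟩
  have h' := congrArg (Polynomial.map Complex.ofRealHom) h
  simp only [Polynomial.map_sub, Polynomial.map_prod, Polynomial.map_sum, Polynomial.map_mul,
    Polynomial.map_X, Polynomial.map_C, Complex.ofRealHom_eq_coe, apply_ite (Polynomial.map _),
    Polynomial.map_one] at h'
  rw [h', Matrix.charpoly]
  have hm : (Matrix.diagonal (fun i => (b i : ℂ)) + Matrix.vecMulVec
      (fun i => (Real.sqrt (c i) : ℂ)) (star fun i => (Real.sqrt (c i) : ℂ))).charmatrix =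
      Matrix.diagonal (fun i => X - C (b i : ℂ)) - Matrix.vecMulVec
        (fun i => C (Real.sqrt (c i) : ℂ)) (fun i => C (Real.sqrt (c i) : ℂ)) := by
    ext1 i j
    by_cases hij : i = j
    · subst hij
      simp [Matrix.vecMulVec_apply]
      ring
    · simp [Matrix.vecMulVec_apply, hij]
  rw [hm, det_diagonal_sub_vecMulVec _ _ _ fun i => X_sub_C_ne_zero _]
  congr 1
  refine Finset.sum_congr rfl fun i _ => ?_
  rw [← C_mul, ← Complex.ofReal_mul, Real.mul_self_sqrt (hc i)]

end RankOnePerturbation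

/-! ### Unitary diagonalization and iterated rank one perturbations -/

section Diagonalization

open Matrix

/-- Equal multisets of values force fibres of equal size, and bijections between fibres glue to a
permutation. -/
lemma exists_perm_of_map_univ_eq {n : ℕ} {γ : Type*} {f g : Fin n → γ}
    (h : Finset.univ.val.map f = Finset.univ.val.map g) :
    ∃ σ : Equiv.Perm (Fin n), ∀ i, g (σ i) = f i := by
  classical
  have hcard : ∀ c, Fintype.card {i // f i = c} = Fintype.card {i // g i = c} := by
    intro c
    have := congrArg (Multiset.count c) h
    rw [Multiset.count_map, Multiset.count_map] at this
    rw [Fintype.card_subtype, Fintype.card_subtype, Finset.card, Finset.card]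
    simpa [eq_comm] using this
  exact ⟨Equiv.ofFiberEquiv fun c => Fintype.equivOfCardEq (hcard c),
    fun i => Equiv.ofFiberEquiv_map _ i⟩

/-- A Hermitian matrix is unitarily diagonalizable, with the eigenvalues in any given order. -/
lemma exists_unitary_diagonalization {n : ℕ} {A : Matrix (Fin n) (Fin n) ℂ} {a : Fin n → ℝ}
    (hA : A.IsHermitian) (ha : HasEigenvalues A a) :
    ∃ U : Matrix (Fin n) (Fin n) ℂ, Uᴴ * U = 1 ∧ U * Uᴴ = 1 ∧
      A = U * diagonal (fun i => (a i : ℂ)) * Uᴴ := by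
  have h := hA.roots_charpoly_eq_eigenvalues
  rw [HasEigenvalues] at ha
  rw [ha] at h
  obtain ⟨σ, hσ⟩ := exists_perm_of_map_univ_eq h
  set V : Matrix (Fin n) (Fin n) ℂ := hA.eigenvectorUnitary.1
  have h1 : Vᴴ * V = 1 := Unitary.coe_star_mul_self _
  have h2 : V * Vᴴ = 1 := Unitary.coe_mul_star_self _
  have h3 : A = V * diagonal (RCLike.ofReal ∘ hA.eigenvalues) * Vᴴ := by
    conv_lhs => rw [hA.spectral_theorem, Unitary.conjStarAlgAut_apply]
    rfl
  refine ⟨V.submatrix id σ, ?_, ?_, ?_⟩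
  · rw [conjTranspose_submatrix, submatrix_mul _ _ _ id _ Function.bijective_id |>.symm, h1,
      submatrix_one_equiv]
  · rw [conjTranspose_submatrix, submatrix_mul _ _ _ σ _ σ.bijective |>.symm, h2, submatrix_id_id]
  · have h4 : diagonal (fun i => (a i : ℂ)) =
        (diagonal (RCLike.ofReal ∘ hA.eigenvalues) : Matrix _ _ ℂ).submatrix σ σ := by
      rw [submatrix_diagonal_equiv]
      congr 1
      ext i
      exact (hσ i).symm
    rw [conjTranspose_submatrix, h4, submatrix_mul _ _ _ σ _ σ.bijective |>.symm,
      submatrix_mul _ _ _ σ _ σ.bijective |>.symm, submatrix_id_id]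
    exact h3

lemma HasEigenvalues.conj {n : ℕ} {A U : Matrix (Fin n) (Fin n) ℂ} {a : Fin n → ℝ}
    (hA : HasEigenvalues A a) (hU : Uᴴ * U = 1) : HasEigenvalues (U * A * Uᴴ) a := by
  rwa [HasEigenvalues, charpoly_mul_comm, ← mul_assoc, hU, one_mul]

lemma hasEigenvalues_diagonal {n : ℕ} (a : Fin n → ℝ) :
    HasEigenvalues (diagonal fun i => (a i : ℂ)) a :=
  hasEigenvalues_of_charpoly (charpoly_diagonal _)

/-- A Hermitian matrix has a positive semidefinite rank one perturbation with any prescribed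
interlacing spectrum. -/
lemma exists_hasEigenvalues_add_vecMulVec {n : ℕ} {B : Matrix (Fin n) (Fin n) ℂ}
    {a b : Fin n → ℝ} (hB : B.IsHermitian) (hb : HasEigenvalues B b)
    (hba : ∀ i, b i ≤ a i) (hab : ∀ i j, i < j → a j ≤ b i) :
    ∃ v : Fin n → ℂ, HasEigenvalues (B + vecMulVec v (star v)) a := by
  obtain ⟨U, hU, -, rfl⟩ := exists_unitary_diagonalization hB hb
  obtain ⟨w, hw⟩ := exists_hasEigenvalues_diagonal_add_vecMulVec a b hba hab
  refine ⟨U *ᵥ w, ?_⟩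
  have := hw.conj hU
  rwa [mul_add, add_mul, mul_vecMulVec, vecMulVec_mul, ← star_mulVec] at this

lemma rank_add_le_add_rank {n : ℕ} (A B : Matrix (Fin n) (Fin n) ℂ) :
    (A + B).rank ≤ A.rank + B.rank := by
  rw [rank, rank, rank, mulVecLin_add]
  exact (Submodule.finrank_mono (LinearMap.range_add_le _ _)).trans
    (Submodule.finrank_add_le_finrank_add_finrank _ _)

/-- The entry of an antitone tuple `b` at the position `i - t`, capped by the entry of `a` at `i`
(and only the latter if `i < t`). -/
noncomputable def cappedShift {n : ℕ} (a b : Fin n → ℝ) (t : ℕ) (i : Fin n) : ℝ :=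
  if t ≤ (i : ℕ) then min (a i) (b ⟨i - t, by omega⟩) else a i

lemma cappedShift_antitone {n : ℕ} {a b : Fin n → ℝ} (ha : Antitone a) (hb : Antitone b) (t : ℕ) :
    Antitone (cappedShift a b t) := by
  intro i j hij
  have hij' : (i : ℕ) ≤ j := hij
  have h1 := ha hij
  unfold cappedShift
  split_ifs with h2 h3 h3
  · exact min_le_min h1 (hb (by simp only [Fin.mk_le_mk]; omega))
  · exact (min_le_left _ _).trans h1
  · omega
  · exact h1

/-- Together with `cappedShift_succ_le`, this makes stages `t` and `t + 1` interlace, as a rank one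
step requires. -/
lemma cappedShift_le_succ {n : ℕ} {a b : Fin n → ℝ} (hb : Antitone b) (t : ℕ) (i : Fin n) :
    cappedShift a b t i ≤ cappedShift a b (t + 1) i := by
  unfold cappedShift
  split_ifs
  · exact min_le_min le_rfl (hb (by simp only [Fin.mk_le_mk]; omega))
  · exact min_le_left _ _
  · omega
  · exact le_rfl

lemma cappedShift_succ_le {n : ℕ} {a b : Fin n → ℝ} (ha : Antitone a) (hb : Antitone b) (t : ℕ)
    {i j : Fin n} (hij : i < j) : cappedShift a b (t + 1) j ≤ cappedShift a b t i := by
  have hij' : (i : ℕ) < j := hij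
  have h1 := ha hij.le
  unfold cappedShift
  split_ifs with h2 h3 h3
  · exact min_le_min h1 (hb (by simp only [Fin.mk_le_mk]; omega))
  · exact (min_le_left _ _).trans h1
  · omega
  · exact h1

/-- A Hermitian matrix with spectrum `b` has positive semidefinite perturbations of rank at most
`t` with spectrum `cappedShift a b t`. -/
lemma exists_posSemidef_add_hasEigenvalues {n : ℕ} {a b : Fin n → ℝ} (ha : Antitone a)
    (hb : Antitone b) (hba : ∀ i, b i ≤ a i) {B : Matrix (Fin n) (Fin n) ℂ} (hB : B.IsHermitian)
    (hBb : HasEigenvalues B b) (t : ℕ) :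
    ∃ P : Matrix (Fin n) (Fin n) ℂ, P.PosSemidef ∧ P.rank ≤ t ∧
      HasEigenvalues (B + P) (cappedShift a b t) := by
  induction t with
  | zero =>
    -- At stage 0 the cap is inactive because b ≤ a, so the spectrum is `b` itself.
    refine ⟨0, PosSemidef.zero, by simp, ?_⟩
    convert hBb using 1
    · simp
    · ext i
      simp [cappedShift, hba i]
  | succ t ih =>
    obtain ⟨P, hP, hr, he⟩ := ih
    obtain ⟨v, hv⟩ := exists_hasEigenvalues_add_vecMulVec (hB.add hP.isHermitian) he
      (cappedShift_le_succ hb t) (fun i j hij => cappedShift_succ_le ha hb t hij)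
    refine ⟨P + vecMulVec v (star v), hP.add (posSemidef_vecMulVec_self_star v), ?_, ?_⟩
    · exact (rank_add_le_add_rank _ _).trans (add_le_add hr (rank_vecMulVec_le _ _))
    · rwa [← add_assoc]

end Diagonalization

/-! ### Weyl inequalities and the spectral criterion -/

section Interlacing

open Matrix

/-- The quadratic form of `A = U D Uᴴ` in the coordinates given by `U`. -/
lemma star_dotProduct_mulVec_of_eq {n : ℕ} {A U : Matrix (Fin n) (Fin n) ℂ} {a : Fin n → ℝ}
    (hA : A = U * diagonal (fun i => (a i : ℂ)) * Uᴴ) (x : Fin n → ℂ) :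
    star x ⬝ᵥ (A *ᵥ x) = ((∑ i, a i * Complex.normSq ((Uᴴ *ᵥ x) i) : ℝ) : ℂ) := by
  have h : star x ⬝ᵥ (A *ᵥ x) =
      star (Uᴴ *ᵥ x) ⬝ᵥ (diagonal (fun i => (a i : ℂ)) *ᵥ (Uᴴ *ᵥ x)) := by
    rw [hA, star_mulVec, conjTranspose_conjTranspose, ← dotProduct_mulVec, mulVec_mulVec,
      mulVec_mulVec, mul_assoc]
  rw [h, dotProduct, Complex.ofReal_sum]
  refine Finset.sum_congr rfl fun i _ => ?_
  rw [mulVec_diagonal, Complex.ofReal_mul, Complex.normSq_eq_conj_mul_self, Pi.star_apply,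
    Complex.star_def]
  ring

/-- The quadratic form of the identity matrix is evaluated in the basis `U` and in the standard
basis. -/
lemma sum_normSq_conjTranspose_mulVec {n : ℕ} {U : Matrix (Fin n) (Fin n) ℂ} (hU : U * Uᴴ = 1)
    (x : Fin n → ℂ) :
    ∑ i, Complex.normSq ((Uᴴ *ᵥ x) i) = ∑ i, Complex.normSq (x i) := by
  have h1 := star_dotProduct_mulVec_of_eq (A := 1) (U := U) (a := 1) (by simp [hU]) x
  have h2 := star_dotProduct_mulVec_of_eq (A := 1) (U := 1) (a := 1) (n := n) (by simp) x
  rw [h1] at h2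
  simpa using Complex.ofReal_injective h2

lemma re_star_dotProduct_mulVec_le {n : ℕ} {A U : Matrix (Fin n) (Fin n) ℂ} {a : Fin n → ℝ}
    (hU : U * Uᴴ = 1) (hA : A = U * diagonal (fun i => (a i : ℂ)) * Uᴴ) {x : Fin n → ℂ} {m : ℝ}
    (h : ∀ i, m < a i → (Uᴴ *ᵥ x) i = 0) :
    (star x ⬝ᵥ (A *ᵥ x)).re ≤ m * ∑ i, Complex.normSq (x i) := by
  rw [star_dotProduct_mulVec_of_eq hA, Complex.ofReal_re, ← sum_normSq_conjTranspose_mulVec hU,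
    Finset.mul_sum]
  refine Finset.sum_le_sum fun i _ => ?_
  obtain hi | hi := le_or_gt (a i) m
  · exact mul_le_mul_of_nonneg_right hi (Complex.normSq_nonneg _)
  · simp [h i hi]

lemma le_re_star_dotProduct_mulVec {n : ℕ} {A U : Matrix (Fin n) (Fin n) ℂ} {a : Fin n → ℝ}
    (hU : U * Uᴴ = 1) (hA : A = U * diagonal (fun i => (a i : ℂ)) * Uᴴ) {x : Fin n → ℂ} {m : ℝ}
    (h : ∀ i, a i < m → (Uᴴ *ᵥ x) i = 0) :
    m * ∑ i, Complex.normSq (x i) ≤ (star x ⬝ᵥ (A *ᵥ x)).re := by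
  rw [star_dotProduct_mulVec_of_eq hA, Complex.ofReal_re, ← sum_normSq_conjTranspose_mulVec hU,
    Finset.mul_sum]
  refine Finset.sum_le_sum fun i _ => ?_
  obtain hi | hi := le_or_gt m (a i)
  · exact mul_le_mul_of_nonneg_right hi (Complex.normSq_nonneg _)
  · simp [h i hi]

/-- All conditions together form one linear map into a space of dimension less than n. Its last
component is restricted to the range of `M`, so that it costs only the rank. -/
lemma exists_ne_zero_mulVec_eq_zero {n : ℕ} (K L M : Matrix (Fin n) (Fin n) ℂ)
    (S T : Finset (Fin n)) (h : S.card + T.card + M.rank < n) :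
    ∃ x : Fin n → ℂ, x ≠ 0 ∧ (∀ i ∈ S, (K *ᵥ x) i = 0) ∧ (∀ i ∈ T, (L *ᵥ x) i = 0) ∧
      M *ᵥ x = 0 := by
  set f : (Fin n → ℂ) →ₗ[ℂ] (S → ℂ) × (T → ℂ) × LinearMap.range M.mulVecLin :=
    (LinearMap.funLeft ℂ ℂ Subtype.val ∘ₗ K.mulVecLin).prod
      ((LinearMap.funLeft ℂ ℂ Subtype.val ∘ₗ L.mulVecLin).prod M.mulVecLin.rangeRestrict)
  have hlt : Module.finrank ℂ ((S → ℂ) × (T → ℂ) × LinearMap.range M.mulVecLin) <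
      Module.finrank ℂ (Fin n → ℂ) := by
    rw [Matrix.rank] at h
    simpa [Module.finrank_prod, ← add_assoc] using h
  obtain ⟨x, hx, hx0⟩ := Submodule.exists_mem_ne_zero_of_ne_bot
    (LinearMap.ker_ne_bot_of_finrank_lt (f := f) hlt)
  have hx' : f x = 0 := hx
  exact ⟨x, hx0, fun i hi => congrFun (congrArg Prod.fst hx') ⟨i, hi⟩,
    fun i hi => congrFun (congrArg (fun y => y.2.1) hx') ⟨i, hi⟩,
    congrArg (fun y => (y.2.2 : Fin n → ℂ)) hx'⟩

lemma sum_normSq_pos {n : ℕ} {x : Fin n → ℂ} (hx : x ≠ 0) : 0 < ∑ i, Complex.normSq (x i) := by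
  obtain ⟨i, hi⟩ := Function.ne_iff.mp hx
  exact Finset.sum_pos' (fun j _ => Complex.normSq_nonneg _)
    ⟨i, Finset.mem_univ _, Complex.normSq_pos.mpr hi⟩

/-- Weyl's inequality for a positive semidefinite sum. -/
lemma add_nonneg_of_posSemidef_add {n : ℕ} {A B : Matrix (Fin n) (Fin n) ℂ} {a b : Fin n → ℝ}
    (ha : Antitone a) (hb : Antitone b) (hA : A.IsHermitian) (hB : B.IsHermitian)
    (hAa : HasEigenvalues A a) (hBb : HasEigenvalues B b) (hP : (A + B).PosSemidef) {i j : Fin n}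
    (hij : (i : ℕ) + j < n) : 0 ≤ a i + b j := by
  obtain ⟨U, -, hU, hUA⟩ := exists_unitary_diagonalization hA hAa
  obtain ⟨V, -, hV, hVB⟩ := exists_unitary_diagonalization hB hBb
  -- Killing the components before i and before j costs i + j < n conditions and leaves Rayleigh
  -- quotients at most a_i and b_j.
  obtain ⟨x, hx, h1, h2, -⟩ := exists_ne_zero_mulVec_eq_zero Uᴴ Vᴴ 0 (Finset.Iio i)
    (Finset.Iio j) (by simpa using hij)
  have h3 := re_star_dotProduct_mulVec_le hU hUA (x := x) (m := a i)
    fun k hk => h1 k (Finset.mem_Iio.mpr (ha.reflect_lt hk))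
  have h4 := re_star_dotProduct_mulVec_le hV hVB (x := x) (m := b j)
    fun k hk => h2 k (Finset.mem_Iio.mpr (hb.reflect_lt hk))
  have h5 := (Complex.le_def.mp (hP.dotProduct_mulVec_nonneg x)).1
  rw [add_mulVec, dotProduct_add, Complex.add_re, Complex.zero_re] at h5
  exact nonneg_of_mul_nonneg_left (by linarith) (sum_normSq_pos hx)

/-- Weyl's inequality for a sum of small rank. -/
lemma add_nonpos_of_rank_add_le {n r : ℕ} {A B : Matrix (Fin n) (Fin n) ℂ} {a b : Fin n → ℝ}
    (ha : Antitone a) (hb : Antitone b) (hA : A.IsHermitian) (hB : B.IsHermitian)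
    (hAa : HasEigenvalues A a) (hBb : HasEigenvalues B b) (hr : (A + B).rank ≤ r) {i j : Fin n}
    (hij : n + r < (i : ℕ) + j + 2) : a i + b j ≤ 0 := by
  obtain ⟨U, -, hU, hUA⟩ := exists_unitary_diagonalization hA hAa
  obtain ⟨V, -, hV, hVB⟩ := exists_unitary_diagonalization hB hBb
  -- Dually, the components after i and after j are killed, and x is taken in the kernel of A + B:
  -- at most (n - 1 - i) + (n - 1 - j) + r < n conditions.
  obtain ⟨x, hx, h1, h2, h6⟩ := exists_ne_zero_mulVec_eq_zero Uᴴ Vᴴ (A + B) (Finset.Ioi i)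
    (Finset.Ioi j) (by simp only [Fin.card_Ioi]; omega)
  have h3 := le_re_star_dotProduct_mulVec hU hUA (x := x) (m := a i)
    fun k hk => h1 k (Finset.mem_Ioi.mpr (ha.reflect_lt hk))
  have h4 := le_re_star_dotProduct_mulVec hV hVB (x := x) (m := b j)
    fun k hk => h2 k (Finset.mem_Ioi.mpr (hb.reflect_lt hk))
  have h5 : (star x ⬝ᵥ ((A + B) *ᵥ x)).re = 0 := by simp [h6]
  rw [add_mulVec, dotProduct_add, Complex.add_re] at h5
  exact nonpos_of_mul_nonpos_left (by linarith) (sum_normSq_pos hx)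

lemma hasEigenvalues_comp_perm {n : ℕ} {A : Matrix (Fin n) (Fin n) ℂ} {a : Fin n → ℝ}
    (σ : Equiv.Perm (Fin n)) (h : HasEigenvalues A (a ∘ σ)) : HasEigenvalues A a := by
  rw [HasEigenvalues] at h ⊢
  rw [h]
  conv_rhs => rw [← Multiset.map_univ_val_equiv σ, Multiset.map_map]
  rfl

/-- The spectral characterization of pairs of Hermitian matrices whose sum is positive
semidefinite of rank at most `r`. -/
lemma realizable_iff {n r : ℕ} {α : TuplePair n} (hα : ∀ s, Antitone (α s)) :
    Realizable r α ↔
      ((∀ i j : Fin n, ((i : ℕ) + 1) + ((j : ℕ) + 1) = n + 1 → 0 ≤ α 0 i + α 1 j) ∧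
        (∀ i j : Fin n, ((i : ℕ) + 1) + ((j : ℕ) + 1) = n + r + 1 → α 0 i + α 1 j ≤ 0)) := by
  constructor
  · rintro ⟨A, hA, hP, hrk⟩
    exact ⟨fun i j hij => add_nonneg_of_posSemidef_add (hα 0) (hα 1) (hA 0).1 (hA 1).1 (hA 0).2
        (hA 1).2 hP (by omega),
      fun i j hij => add_nonpos_of_rank_add_le (hα 0) (hα 1) (hA 0).1 (hA 1).1 (hA 0).2
        (hA 1).2 hrk (by omega)⟩
  · rintro ⟨h1, h2⟩
    set b : Fin n → ℝ := fun i => -α 1 i.rev with hb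
    have hb_anti : Antitone b := fun i j hij => neg_le_neg (hα 1 (Fin.rev_le_rev.mpr hij))
    have hba : ∀ i, b i ≤ α 0 i := fun i => by
      have := h1 i i.rev (by rw [Fin.val_rev]; omega)
      rw [hb]
      linarith
    -- By (◁), a_i ≤ b_{i-r}, so at stage r the minimum is always a_i.
    have hshift : cappedShift (α 0) b r = α 0 := by
      ext i
      unfold cappedShift
      split_ifs with h
      · refine min_eq_left ?_
        have := h2 i (Fin.rev ⟨i - r, by omega⟩) (by rw [Fin.val_rev]; simp only; omega)
        rw [hb]
        linarith
      · rfl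
    have hdiag : ∀ a : Fin n → ℝ, (diagonal fun i => (a i : ℂ)).IsHermitian := fun a => by
      rw [IsHermitian, diagonal_conjTranspose]
      congr 1
      ext i
      simp
    obtain ⟨P, hP, hPr, hPe⟩ := exists_posSemidef_add_hasEigenvalues (hα 0) hb_anti hba
      (hdiag b) (hasEigenvalues_diagonal b) r
    rw [hshift] at hPe
    have hsum : diagonal (fun i => (b i : ℂ)) + P + diagonal (fun i => ((-b i : ℝ) : ℂ)) = P := by
      rw [add_right_comm, diagonal_add]
      simp
    -- The second matrix is -diag(b), whose diagonal is α(2) in reverse order, so the sum is exactly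
    -- P.
    refine ⟨![diagonal (fun i => (b i : ℂ)) + P, diagonal (fun i => ((-b i : ℝ) : ℂ))], ?_, ?_, ?_⟩
    · rw [Fin.forall_fin_two]
      refine ⟨⟨(hdiag b).add hP.isHermitian, hPe⟩, hdiag _,
        hasEigenvalues_comp_perm Fin.revPerm ?_⟩
      have : α 1 ∘ Fin.revPerm = fun i => -b i := by
        ext i
        simp [hb]
      rw [this]
      exact hasEigenvalues_diagonal fun i => -b i
    · exact hsum.symm ▸ hP
    · exact hsum.symm ▸ hPr

end Interlacing

/-! ### Facets of a polyhedral cone from witness points -/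

section Facets

open Filter Topology

/-- Strict inequalities survive a small move by continuity; tight ones stay tight because the
direction lies in their kernel. -/
lemma exists_pos_forall_nonneg_add_smul {V ι : Type*} [AddCommGroup V] [Module ℝ V] [Finite ι]
    {f : ι → V → ℝ} (hf : ∀ i, IsLinearMap ℝ (f i)) {x v : V}
    (h : ∀ i, 0 < f i x ∨ f i x = 0 ∧ f i v = 0) :
    ∃ ε : ℝ, 0 < ε ∧ ∀ i, 0 ≤ f i (x + ε • v) := by
  have hev : ∀ i, ∀ᶠ ε : ℝ in 𝓝[>] 0, 0 ≤ f i (x + ε • v) := by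
    intro i
    simp only [(hf i).map_add, (hf i).map_smul, smul_eq_mul]
    obtain hi | ⟨h1, h2⟩ := h i
    · have ht : Tendsto (fun ε : ℝ => f i x + ε * f i v) (𝓝 0) (𝓝 (f i x + 0 * f i v)) :=
        Continuous.tendsto (by fun_prop) 0
      exact ((ht.mono_left nhdsWithin_le_nhds).eventually_const_lt (by simpa using hi)).mono
        fun _ => le_of_lt
    · simp [h1, h2]
  obtain ⟨ε, hε, hpos⟩ := ((eventually_all.mpr hev).and self_mem_nhdsWithin).exists
  exact ⟨ε, hpos, hε⟩

/-- A subfamily of the inequalities `0 ≤ f i` that define a cone is independent if all of them hold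
strictly at some point, and each one of the subfamily is an equality at some point where all the
others hold strictly. -/
lemma independentInequalities_of_witnesses {n : ℕ} {κ ι : Type} [Finite ι]
    {f : ι → TuplePair n → ℝ} (hf : ∀ i, IsLinearMap ℝ (f i)) {C : Set (TuplePair n)}
    (hC : C = {x | ∀ i, 0 ≤ f i x}) {e : κ → ι} (he : Function.Injective e) {p : TuplePair n}
    (hp : ∀ i, 0 < f i p) {q : κ → TuplePair n} (hq : ∀ k, f (e k) (q k) = 0)
    (hq' : ∀ k i, i ≠ e k → 0 < f i (q k)) :
    IndependentInequalities C (fun k => f (e k)) := by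
  have hqC : ∀ k, q k ∈ C := by
    intro k
    rw [hC]
    intro i
    obtain rfl | hi := eq_or_ne i (e k)
    · exact (hq k).ge
    · exact (hq' k i hi).le
  have hspan : ∀ (F : Set (TuplePair n)) (x v : TuplePair n) (ε : ℝ), 0 < ε → x ∈ F →
      x + ε • v ∈ F → v ∈ vectorSpan ℝ F := by
    intro F x v ε hε hx hxv
    have := Submodule.smul_mem _ ε⁻¹ (vsub_mem_vectorSpan ℝ hxv hx)
    rwa [vsub_eq_sub, add_sub_cancel_left, inv_smul_smul₀ hε.ne'] at this
  refine ⟨fun k => ⟨⟨q k, hqC k, hq k⟩, ?_, ?_⟩, ?_, fun k => ?_⟩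
  · intro _
    -- On C the form is nonnegative and vanishes at `q k`, so its negative is maximal exactly on the
    -- face.
    refine ⟨-LinearMap.toContinuousLinearMap (hf (e k)).mk', ?_⟩
    ext x
    simp only [Set.mem_ofPred_eq, neg_apply,
      LinearMap.coe_toContinuousLinearMap', IsLinearMap.mk'_apply, neg_le_neg_iff]
    refine and_congr_right fun hx => ⟨fun h y hy => ?_, fun h => ?_⟩
    · rw [hC] at hy
      exact h.trans_le (hy (e k))
    · rw [hC] at hx
      exact le_antisymm ((h _ (hqC k)).trans_eq (hq k)) (hx (e k))
  · have hF : vectorSpan ℝ {α ∈ C | f (e k) α = 0} = LinearMap.ker (hf (e k)).mk' := by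
      refine le_antisymm ?_ fun v hv => ?_
      · rw [vectorSpan_def, Submodule.span_le]
        rintro _ ⟨x, hx, y, hy, rfl⟩
        simp [LinearMap.mem_ker, vsub_eq_sub, (hf (e k)).map_sub, hx.2, hy.2]
      · have hv' : f (e k) v = 0 := hv
        obtain ⟨ε, hε, h⟩ := exists_pos_forall_nonneg_add_smul hf (x := q k) (v := v) fun i => by
          obtain rfl | hi := eq_or_ne i (e k)
          · exact Or.inr ⟨hq k, hv'⟩
          · exact Or.inl (hq' k i hi)
        refine hspan _ (q k) v ε hε ⟨hqC k, hq k⟩ ⟨by rw [hC]; exact h, ?_⟩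
        rw [(hf _).map_add, (hf _).map_smul, hq, hv', smul_zero, add_zero]
    have hCtop : vectorSpan ℝ C = ⊤ := by
      refine eq_top_iff.mpr fun v _ => ?_
      obtain ⟨ε, hε, h⟩ := exists_pos_forall_nonneg_add_smul hf (x := p) (v := v)
        fun i => Or.inl (hp i)
      rw [hC]
      exact hspan _ p v ε hε (fun i => (hp i).le) h
    rw [hF, hCtop, finrank_top]
    refine Module.Dual.finrank_ker_add_one_of_ne_zero fun h => (hp (e k)).ne' ?_
    exact LinearMap.congr_fun h p
  · intro k l hkl
    by_contra hne
    have : q k ∈ {α ∈ C | f (e l) α = 0} := by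
      have h : {α ∈ C | f (e k) α = 0} = {α ∈ C | f (e l) α = 0} := hkl
      rw [← h]
      exact ⟨hqC k, hq k⟩
    exact (hq' k (e l) fun h => hne (he h).symm).ne' this.2
  -- Moving slightly from `q k` away from the interior point `p` violates inequality k and keeps the
  -- others.
  · obtain ⟨ε, hε, h⟩ := exists_pos_forall_nonneg_add_smul (ι := {i // i ≠ e k})
      (f := fun i => f i) (fun i => hf i) (x := q k) (v := -p) fun i => Or.inl (hq' k i i.2)
    refine ⟨q k + ε • -p, ?_, fun l hl => h ⟨e l, fun h => hl (he h)⟩⟩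
    rw [(hf _).map_add, (hf _).map_smul, (hf _).map_neg, hq, smul_eq_mul, zero_add]
    nlinarith [hp (e k)]

end Facets

/-! ### Explicit witness points and the case r = 1 -/

section EigenvalueCone

lemma isLinearMap_allForms (n r : ℕ) (k) : IsLinearMap ℝ (allForms n r k) := by
  rcases k with k | k | k <;> constructor <;> intros <;>
    simp [allForms, eigenvalueForms, orderForm, positivityForm, rankForm] <;> ring

lemma antitone_iff_orderForm {n : ℕ} {α : TuplePair n} :
    (∀ s, Antitone (α s)) ↔ ∀ k, 0 ≤ orderForm n k α := by
  constructor
  · rintro h ⟨s, ⟨i, j⟩, hij⟩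
    simp only at hij
    exact sub_nonneg.mpr (h s (show i ≤ j from Fin.le_def.mpr (by omega)))
  · intro h s
    cases n with
    | zero => exact fun i => i.elim0
    | succ n =>
      exact Fin.antitone_iff_succ_le.mpr fun i =>
        sub_nonneg.mp (h ⟨s, ⟨i.castSucc, i.succ⟩, by simp⟩)

lemma admissibleCone_eq {n r : ℕ} :
    admissibleCone n r = {α | ∀ k, 0 ≤ allForms n r k α} := by
  ext α
  simp only [admissibleCone, Set.mem_ofPred_eq, Sum.forall, allForms, eigenvalueForms,
    Sum.elim_inl, Sum.elim_inr, antitone_iff_orderForm]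
  refine and_congr_right fun h => ?_
  rw [realizable_iff (antitone_iff_orderForm.mpr h)]
  simp only [positivityForm, rankForm, Subtype.forall, Prod.forall, neg_nonneg]

/-- A point at which all the inequalities are strict. -/
noncomputable def interiorPoint (n : ℕ) : TuplePair n :=
  ![fun i => -(i : ℝ), fun j => n - j - 1 / 4]

lemma allForms_interiorPoint_pos {n r : ℕ} (hr : 1 ≤ r) (k) :
    0 < allForms n r k (interiorPoint n) := by
  -- With indices from 0, α_i(1) + α_j(2) = n - (i + j) - 1/4. This is 3/4 on (▷), where i + j = n -
  -- 1, and 3/4 - r < 0 on (◁), where i + j = n + r - 1.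
  have hr' : (1 : ℝ) ≤ r := by exact_mod_cast hr
  rcases k with ⟨s, ⟨i, j⟩, h⟩ | ⟨⟨i, j⟩, h⟩ | ⟨⟨i, j⟩, h⟩ <;>
    have h' := congrArg (Nat.cast (R := ℝ)) h <;> push_cast at h'
  · have hlt : i < j := Fin.lt_def.mpr (Nat.lt_of_succ_le h.le)
    fin_cases s <;> simp [allForms, orderForm, interiorPoint, hlt]
  · simp [allForms, eigenvalueForms, positivityForm, interiorPoint]
    linarith
  · simp [allForms, eigenvalueForms, rankForm, interiorPoint]
    linarith

/-- A point at which exactly one of the positivity and rank inequalities is an equality. -/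
noncomputable def eigenvaluePoint (n r : ℕ) :
    SumIndex n (n + 1) ⊕ SumIndex n (n + r + 1) → TuplePair n
  | .inl k => ![fun i => -(i : ℝ), fun j => n - j - 1 / 4 - if j = k.1.2 then 3 / 4 else 0]
  | .inr k => ![fun i => -(i : ℝ), fun j => n + r - 1 - j - 1 / 4 + if j = k.1.2 then 1 / 4 else 0]

/-- A point at which exactly one of the order inequalities is an equality. -/
noncomputable def orderPoint (n : ℕ) (k : OrderIndex n) : TuplePair n :=
  fun s i => interiorPoint n s i + if s = k.1 ∧ i = k.2.1.2 then 1 else 0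

lemma allForms_eigenvaluePoint_self (n r : ℕ) (k) :
    allForms n r (.inr k) (eigenvaluePoint n r k) = 0 := by
  rcases k with ⟨⟨i, j⟩, h⟩ | ⟨⟨i, j⟩, h⟩ <;>
    have h' := congrArg (Nat.cast (R := ℝ)) h <;> push_cast at h' <;>
    simp [allForms, eigenvalueForms, positivityForm, rankForm, eigenvaluePoint] <;> linarith

/-- Before the change at one entry, all sums are 3/4 on (▷), respectively -1/4 on (◁). Changing
α_j(2) by that amount makes one sum vanish, and only that one in its family since j determines i.
Order gaps start at 1 and lose at most 3/4. -/
lemma allForms_eigenvaluePoint_pos {n r : ℕ} (hr : 1 ≤ r) (k) (l) (hl : l ≠ .inr k) :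
    0 < allForms n r l (eigenvaluePoint n r k) := by
  have hr' : (1 : ℝ) ≤ r := by exact_mod_cast hr
  rcases k with ⟨⟨i₀, j₀⟩, h₀⟩ | ⟨⟨i₀, j₀⟩, h₀⟩ <;>
    rcases l with ⟨s, ⟨i, j⟩, h⟩ | ⟨⟨i, j⟩, h⟩ | ⟨⟨i, j⟩, h⟩ <;>
    have h' := congrArg (Nat.cast (R := ℝ)) h <;> push_cast at h'
  · have hlt : i < j := Fin.lt_def.mpr (Nat.lt_of_succ_le h.le)
    fin_cases s
    · simp [allForms, orderForm, eigenvaluePoint, hlt]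
    · simp [allForms, orderForm, eigenvaluePoint]
      split_ifs <;> linarith
  · have : j ≠ j₀ := fun e => hl (by
      simp only [Sum.inr.injEq, Sum.inl.injEq, Subtype.mk.injEq, Prod.mk.injEq, Fin.ext_iff]
      simp only [Fin.ext_iff] at e h h₀
      omega)
    simp [allForms, eigenvalueForms, positivityForm, eigenvaluePoint, this]
    linarith
  · simp [allForms, eigenvalueForms, rankForm, eigenvaluePoint]
    split_ifs <;> linarith
  · have hlt : i < j := Fin.lt_def.mpr (Nat.lt_of_succ_le h.le)
    fin_cases s
    · simp [allForms, orderForm, eigenvaluePoint, hlt]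
    · simp [allForms, orderForm, eigenvaluePoint]
      split_ifs <;> linarith
  · simp [allForms, eigenvalueForms, positivityForm, eigenvaluePoint]
    split_ifs <;> linarith
  · have : j ≠ j₀ := fun e => hl (by
      simp only [Sum.inr.injEq, Subtype.mk.injEq, Prod.mk.injEq, Fin.ext_iff]
      simp only [Fin.ext_iff] at e h h₀
      omega)
    simp [allForms, eigenvalueForms, rankForm, eigenvaluePoint, this]
    linarith

lemma allForms_orderPoint_self (n r : ℕ) (k) : allForms n r (.inl k) (orderPoint n k) = 0 := by
  rcases k with ⟨s, ⟨i, j⟩, h⟩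
  have h' := congrArg (Nat.cast (R := ℝ)) h
  have hij : i ≠ j := by
    rintro rfl
    simp at h
  push_cast at h'
  fin_cases s <;> simp [allForms, orderForm, orderPoint, interiorPoint, hij] <;> linarith

/-- Raising one entry by 1 closes the gap before it and widens the one after it. Sums on (◁) grow
from 3/4 - r to at most 7/4 - r, which is negative because r ≥ 2. -/
lemma allForms_orderPoint_pos {n r : ℕ} (hr : 2 ≤ r) (k) (l) (hl : l ≠ .inl k) :
    0 < allForms n r l (orderPoint n k) := by
  have hr' : (2 : ℝ) ≤ r := by exact_mod_cast hr
  rcases k with ⟨s₀, ⟨i₀, j₀⟩, h₀⟩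
  rcases l with ⟨s, ⟨i, j⟩, h⟩ | ⟨⟨i, j⟩, h⟩ | ⟨⟨i, j⟩, h⟩ <;>
    have h' := congrArg (Nat.cast (R := ℝ)) h <;> push_cast at h'
  · have : ¬ (s = s₀ ∧ j = j₀) := fun e => hl (by
      simp only [Sum.inl.injEq, Prod.mk.injEq, Subtype.mk.injEq, Fin.ext_iff]
      simp only [Fin.ext_iff] at e h h₀
      omega)
    simp only [allForms, Sum.elim_inl, orderForm, orderPoint, if_neg this]
    fin_cases s <;> simp [interiorPoint] <;> split_ifs <;> linarith
  · simp [allForms, eigenvalueForms, positivityForm, orderPoint, interiorPoint]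
    split_ifs <;> linarith
  · fin_cases s₀ <;> simp [allForms, eigenvalueForms, rankForm, orderPoint, interiorPoint] <;>
      split_ifs <;> linarith

/-- For `r = 1` the two families interlace the two tuples, which forces them to be decreasing. -/
lemma antitone_of_eigenvalueForms_one {n : ℕ} {α : TuplePair n}
    (h : ∀ k, 0 ≤ eigenvalueForms n 1 k α) (s : Fin 2) : Antitone (α s) := by
  have h1 : ∀ i j : Fin n, (i : ℕ) + j + 1 = n → 0 ≤ α 0 i + α 1 j := fun i j hij =>
    h (.inl ⟨(i, j), by simp only; omega⟩)
  have h2 : ∀ i j : Fin n, (i : ℕ) + j = n → α 0 i + α 1 j ≤ 0 := fun i j hij =>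
    neg_nonneg.mp (h (.inr ⟨(i, j), by simp only; omega⟩))
  revert s
  rw [antitone_iff_orderForm]
  rintro ⟨s, ⟨i, j⟩, hij⟩
  simp only at hij
  have hj : (j.rev : ℕ) = n - (j + 1) := Fin.val_rev j
  have hi : (i.rev : ℕ) = n - (i + 1) := Fin.val_rev i
  fin_cases s <;> simp only [orderForm, Fin.zero_eta, Fin.mk_one]
  -- Interlacing: α_i(1) ≥ -α_{rev i}(2) ≥ α_{i+1}(1); the second tuple is symmetric.
  · linarith [h1 i i.rev (by omega), h2 j i.rev (by omega)]
  · linarith [h1 j.rev j (by omega), h1 i.rev i (by omega), h2 i.rev j (by omega)]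

end EigenvalueCone

theorem corollary2 (n r : ℕ) (hr : r ≤ n) :
    (∀ α : Fin 2 → Fin n → ℝ, (∀ s, Antitone (α s)) →
      ((∃ A : Fin 2 → Matrix (Fin n) (Fin n) ℂ,
          (∀ s, (A s).IsHermitian ∧ HasEigenvalues (A s) (α s)) ∧
            (A 0 + A 1).PosSemidef ∧ (A 0 + A 1).rank ≤ r) ↔
        ((∀ i j : Fin n, ((i : ℕ) + 1) + ((j : ℕ) + 1) = n + 1 → 0 ≤ α 0 i + α 1 j) ∧
          (∀ i j : Fin n, ((i : ℕ) + 1) + ((j : ℕ) + 1) = n + r + 1 → α 0 i + α 1 j ≤ 0)))) ∧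
    (1 ≤ r → IndependentInequalities (admissibleCone n r) (eigenvalueForms n r)) ∧
    (r = 1 → ∀ α : Fin 2 → Fin n → ℝ, (∀ k, 0 ≤ eigenvalueForms n r k α) →
      ∀ s, Antitone (α s)) ∧
    (2 ≤ r → IndependentInequalities (admissibleCone n r) (allForms n r)) := by
  refine ⟨fun α hα => realizable_iff hα, fun h1 => ?_, ?_, fun h2 => ?_⟩
  -- The cone is cut out by all the forms, including (†); only the subfamily selected by `Sum.inr`
  -- is claimed independent.
  · exact independentInequalities_of_witnesses (isLinearMap_allForms n r) admissibleCone_eq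
      Sum.inr_injective (allForms_interiorPoint_pos h1) (allForms_eigenvaluePoint_self n r)
      (allForms_eigenvaluePoint_pos h1)
  · rintro rfl α h
    exact antitone_of_eigenvalueForms_one h
  · refine independentInequalities_of_witnesses (isLinearMap_allForms n r) admissibleCone_eq
      Function.injective_id (allForms_interiorPoint_pos (one_le_two.trans h2))
      (q := Sum.elim (orderPoint n) (eigenvaluePoint n r)) ?_ ?_
    · rintro (k | k)
      · exact allForms_orderPoint_self n r k
      · exact allForms_eigenvaluePoint_self n r k
    · rintro (k | k) l hl
      · exact allForms_orderPoint_pos h2 k l hl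
      · exact allForms_eigenvaluePoint_pos (one_le_two.trans h2) k l hl
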